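/- Let $X$ be a complex Banach space and let $H_b(X)$ be the algebra of all entire functions $f:X\to\mathbb{C}$ that are bounded on bounded subsets of $X$, with the topology of uniform convergence on bounded sets. Let $\mathcal{P}(X)\subset H_b(X)$ be the continuous polynomials on $X$. For $f\in H_b(X)$ with Taylor series $f=\sum_{m\ge 0}P_m$ at $0$, let $\tilde f(z)=\sum_{m\ge 0}\widetilde{P_m}(z)$ ($z\in X^{**}$) be its Aron–Berner extension, where $\widetilde{P_m}(z)=\widetilde{A_m}(z,\dots,z)$ and $\widetilde{A_m}$ is the canonical extension to $X^{**}$ of the symmetric $m$-linear form $A_m$ of $P_m$, obtained by weak-star continuous extension of one variable at a time. The polynomial-star topology on $X^{**}$ is the coarsest topology for which $\tilde P$ is continuous for every $P\in\mathcal{P}(X)$. Let $B_X$ be the open unit ball of $X$. For $r>0$, $f\in H_b(X)$ and $z\in r\overline{B}_{X^{**}}$ put $$Cl_r(f,z)=\{\lambda\in\mathbb{C}:\ \text{there is a net } (x_\alpha)\subset rB_X \text{ with } x_\alpha\to z \text{ in the polynomial-star topology and } f(x_\alpha)\to\lambda\}.$$ Let $\mathcal{M}(H_b(X))$ be the set of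 nonzero continuous multiplicative linear functionals on $H_b(X)$, let $$\mathcal{M}_{z,r}=\{\varphi\in\mathcal{M}(H_b(X)):\ \varphi(P)=\tilde P(z)\ \text{for all } P\in\mathcal{P}(X),\ \ |\varphi(g)|\le\sup_{rB_X}|g|\ \text{for all } g\in H_b(X)\},$$ and let $\hat f(\varphi)=\varphi(f)$ be the Gelfand transform of $f$. Then, for every complex Banach space $X$, every $r>0$, every $f\in H_b(X)$ and every $z\in r\overline{B}_{X^{**}}$, the series defining $\tilde f(z)$ converges absolutely, and $$Cl_r(f,z)=\hat f(\mathcal{M}_{z,r})=\{\tilde f(z)\}.$$ -/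

import Mathlib

open Filter Topology

universe u

noncomputable section

namespace ClusterValue

variable (X : Type u) [NormedAddCommGroup X] [NormedSpace ℂ X]

/-! ### The algebra of entire functions of bounded type -/

/-- The subalgebra of all functions `f : X → ℂ` that are entire (analytic at every point of `X`)
and bounded on every bounded subset of `X`. -/
def entireBoundedType : Subalgebra ℂ (X → ℂ) where
  carrier := {f | AnalyticOnNhd ℂ f Set.univ ∧
    ∀ s : Set X, Bornology.IsBounded s → Bornology.IsBounded (f '' s)}
  mul_mem' := by
    rintro f g ⟨hf, hfb⟩ ⟨hg, hgb⟩
    refine ⟨hf.mul hg, fun s hs => ?_⟩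
    obtain ⟨C, hC⟩ := (hfb s hs).exists_norm_le
    obtain ⟨D, hD⟩ := (hgb s hs).exists_norm_le
    refine isBounded_iff_forall_norm_le.2 ⟨C * D, ?_⟩
    rintro _ ⟨x, hx, rfl⟩
    have h1 := hC _ (Set.mem_image_of_mem f hx)
    have h2 := hD _ (Set.mem_image_of_mem g hx)
    calc ‖f x * g x‖ = ‖f x‖ * ‖g x‖ := norm_mul _ _
      _ ≤ C * D := mul_le_mul h1 h2 (norm_nonneg _) ((norm_nonneg _).trans h1)
  add_mem' := by
    rintro f g ⟨hf, hfb⟩ ⟨hg, hgb⟩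
    refine ⟨hf.add hg, fun s hs => ?_⟩
    obtain ⟨C, hC⟩ := (hfb s hs).exists_norm_le
    obtain ⟨D, hD⟩ := (hgb s hs).exists_norm_le
    refine isBounded_iff_forall_norm_le.2 ⟨C + D, ?_⟩
    rintro _ ⟨x, hx, rfl⟩
    exact (norm_add_le _ _).trans
      (add_le_add (hC _ (Set.mem_image_of_mem f hx)) (hD _ (Set.mem_image_of_mem g hx)))
  algebraMap_mem' := by
    intro c
    refine ⟨fun x _ => analyticAt_const, fun s _ => ?_⟩
    refine isBounded_iff_forall_norm_le.2 ⟨‖c‖, ?_⟩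
    rintro _ ⟨x, _, rfl⟩
    exact le_rfl

/-- The algebra `H_b(X)`. It is a separate type, so that it does not inherit the topology of
pointwise convergence of `X → ℂ`. -/
def Hb : Type u := entireBoundedType X

instance : CommRing (Hb X) := inferInstanceAs (CommRing (entireBoundedType X))

instance : Algebra ℂ (Hb X) := inferInstanceAs (Algebra ℂ (entireBoundedType X))

instance : FunLike (Hb X) X ℂ where
  coe f := f.1
  coe_injective _ _ h := Subtype.ext h

/-- The Fréchet topology of `H_b(X)`: uniform convergence on the bounded subsets of `X`. -/
instance : TopologicalSpace (Hb X) :=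
  TopologicalSpace.induced
    (fun f : Hb X => UniformOnFun.ofFun {s : Set X | Bornology.IsBounded s} (f : X → ℂ))
    inferInstance

variable {X}

/-! ### Polynomials and the Aron-Berner extension -/

/-- Continuous polynomials on `X`: finite sums of functions `x ↦ A (x, …, x)` with `A` a continuous
`k`-linear form. -/
def IsPolynomial (P : X → ℂ) : Prop :=
  ∃ (n : ℕ) (A : ∀ k : ℕ, ContinuousMultilinearMap ℂ (fun _ : Fin k => X) ℂ),
    ∀ x, P x = ∑ k ∈ Finset.range n, A k (fun _ => x)

/-- The canonical (Arens) extension to `X**` of a continuous `n`-linear form `A` on `X`: the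
variables are extended one at a time, the last one first. In each step the continuous linear
functional `x ↦ A (x₁, …, xₙ, x)` is replaced by the value at it of a point `z` of `X**`; this is
the weak-star limit of `A (x₁, …, xₙ, x)` as `x` tends to `z`. -/
def arensExtension : (n : ℕ) → ContinuousMultilinearMap ℂ (fun _ : Fin n => X) ℂ →
    (Fin n → StrongDual ℂ (StrongDual ℂ X)) → ℂ
  | 0, A, _ => A 0
  | n + 1, A, z =>
      arensExtension n ((z (Fin.last n)).compContinuousMultilinearMap A.curryRight) (Fin.init z)

/-- The Aron-Berner extension, at `z`, of the `m`-th Taylor polynomial `x ↦ D^m f(0)(x, …, x) / m!`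
of `f` at `0`. The symmetric `m`-linear form of that polynomial is `D^m f(0) / m!`. -/
def aronBernerTerm (f : X → ℂ) (z : StrongDual ℂ (StrongDual ℂ X)) (m : ℕ) : ℂ :=
  (m.factorial : ℂ)⁻¹ * arensExtension m (iteratedFDeriv ℂ m f 0) (fun _ => z)

/-- The Aron-Berner extension `f̃ : X** → ℂ` of an entire function `f` of bounded type: the sum of
the extensions of its Taylor polynomials at `0`. For a polynomial the sum is finite. -/
def aronBerner (f : X → ℂ) (z : StrongDual ℂ (StrongDual ℂ X)) : ℂ :=
  ∑' m, aronBernerTerm f z m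

variable (X) in
/-- The polynomial-star topology on `X**`: the coarsest topology for which the Aron-Berner
extensions of all polynomials on `X` are continuous. -/
abbrev polynomialStarTopology : TopologicalSpace (StrongDual ℂ (StrongDual ℂ X)) :=
  ⨅ (P : X → ℂ) (_ : IsPolynomial P), TopologicalSpace.induced (aronBerner P) inferInstance

/-! ### Cluster sets and fibers -/

/-- The polynomial `r`-cluster set `Cl_r(f, z)`: all limits of `f (x α)` along nets in the open ball
`r B_X` that converge to `z` in the polynomial-star topology. -/
def clusterSet (r : ℝ) (f : X → ℂ) (z : StrongDual ℂ (StrongDual ℂ X)) : Set ℂ :=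
  {l | ∃ (ι : Type u) (_ : Preorder ι) (_ : IsDirectedOrder ι) (_ : Nonempty ι) (x : ι → X),
    (∀ α, x α ∈ Metric.ball (0 : X) r) ∧
    Tendsto (fun α => NormedSpace.inclusionInDoubleDual ℂ X (x α)) atTop
      (@nhds _ (polynomialStarTopology X) z) ∧
    Tendsto (fun α => f (x α)) atTop (𝓝 l)}

/-- The polynomial `r`-fiber `M_{z,r}` over `z` in the spectrum `M(H_b(X))`, the latter being the
set of all nonzero continuous multiplicative linear functionals: those `φ` that act on polynomials
as evaluation at `z` and satisfy `|φ(f)| ≤ sup_{r B_X} |f|` for every `f`. -/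
def fiber (z : StrongDual ℂ (StrongDual ℂ X)) (r : ℝ) :
    Set (WeakDual.characterSpace ℂ (Hb X)) :=
  {φ | (∀ P : Hb X, IsPolynomial (P : X → ℂ) → φ P = aronBerner P z) ∧
    ∀ f : Hb X, ‖φ f‖ ≤ ⨆ x : Metric.ball (0 : X) r, ‖f x‖}

end ClusterValue

end

/-!
The proof rests on one filter `G` on the open ball of radius `r` of `X` along which every
`f` in `H_b(X)` tends to the value `f̃(z)` of its Aron-Berner extension
(`exists_filter_tendsto_aronBerner`, a form of the Davie-Gamelin theorem).

To build `G`, take a filter `U` on the ball whose points tend to `z` weak-star, by Goldstine's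
theorem. For a symmetric `n`-linear form `A`, the extension of `A` at `z` is the iterated limit of
`A (x₁, …, xₙ)` as `xₙ`, then `xₙ₋₁`, and so on tend to `z` along `U`. In an average of `N` points
chosen one after the other along `U`, almost all index tuples are without repetition, so the value
of `A` on the diagonal at the average is within `O(1 / N)` of its extension at `z`. This is proved
by adding one point at a time (`exists_eventually_norm_sub_arensExtension_le`): adding `x / N` to a
partial average `s` changes `A (s, …, s)` by `n / N * A (s, …, s, x)` up to `O(1 / N ^ 2)`, and
`A (s, …, s, x)` is close to the form with one variable extended to `z`, to which induction on `n`
applies. Letting `N` tend to infinity gives `G` for homogeneous polynomials. Iterated Cauchy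
estimates make the Taylor series of `f` normally convergent on balls, and dominated convergence
passes to `f`.

Evaluation of `f̃` at `z` is therefore a limit of evaluations on the ball, hence multiplicative and
bounded by the supremum over the ball; so it belongs to the fiber, and a net subordinate to `G` puts
`f̃(z)` in the cluster set. Conversely, Taylor polynomials approximate `f` uniformly on the ball, and
both a cluster value and the value of a character in the fiber are determined on polynomials and
controlled by the supremum over the ball, so they equal `f̃(z)`
(`eq_aronBerner_of_forall_isPolynomial`).
-/

noncomputable section

namespace ClusterValue

variable {X : Type u} [NormedAddCommGroup X] [NormedSpace ℂ X]

/-! ### Weak-star approximation of bidual points -/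

/-- Goldstine's theorem for finitely many functionals: the open ball of radius `r` in `X` is
weak-star dense in the closed ball of radius `r` of the bidual. -/
theorem mem_closure_image_ball {r : ℝ} (hr : 0 < r) {z : StrongDual ℂ (StrongDual ℂ X)}
    (hz : ‖z‖ ≤ r) {ι : Type*} [Finite ι] (p : ι → StrongDual ℂ X) :
    (fun i => z (p i)) ∈ closure ((fun x i => p i x) '' Metric.ball (0 : X) r) := by
  classical
  have := Fintype.ofFinite ι
  by_contra hmem
  have hconv : Convex ℝ (closure ((fun x i => p i x) '' Metric.ball (0 : X) r)) := by
    refine Convex.closure ?_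
    exact (convex_ball (0 : X) r).is_linear_image (f := fun x i => p i x)
      ⟨fun x y => by ext; simp, fun c x => by ext; simp⟩
  obtain ⟨l, b, hlb, hbl⟩ := RCLike.geometric_hahn_banach_closed_point (𝕜 := ℂ) hconv
    isClosed_closure hmem
  -- The separating functional on `ℂ^ι` pulls back to a functional `ψ` on `X`.
  set ψ : StrongDual ℂ X := ∑ i, l (Pi.single i 1) • p i with hψ
  have hl : ∀ y : ι → ℂ, l y = ∑ i, l (Pi.single i 1) * y i := by
    intro y
    conv_lhs => rw [pi_eq_sum_univ' y, map_sum]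
    refine Finset.sum_congr rfl fun i _ => ?_
    rw [map_smul, smul_eq_mul, mul_comm]
  have hlx : ∀ x, l (fun i => p i x) = ψ x := by
    intro x
    rw [hl, hψ]
    simp
  have hlz : l (fun i => z (p i)) = z ψ := by
    rw [hl, hψ, map_sum]
    simp
  have hball : ∀ x ∈ Metric.ball (0 : X) r, ‖ψ x‖ ≤ b := by
    intro x hx
    obtain ⟨d, hd, hdx⟩ : ∃ d : ℂ, ‖d‖ = 1 ∧ d * ψ x = ‖ψ x‖ := by
      by_cases h0 : ψ x = 0
      · exact ⟨1, by simp, by simp [h0]⟩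
      · refine ⟨(‖ψ x‖ : ℂ) / ψ x, ?_, div_mul_cancel₀ _ h0⟩
        rw [norm_div, Complex.norm_real, norm_norm, div_self (norm_ne_zero_iff.2 h0)]
    have h1 := hlb (fun i => p i (d • x)) (subset_closure ⟨d • x, by
      simpa [norm_smul, hd] using hx, rfl⟩)
    rw [hlx, map_smul, smul_eq_mul, hdx] at h1
    simpa using h1.le
  have hclosed : ∀ x ∈ Metric.closedBall (0 : X) r, ‖ψ x‖ ≤ b := by
    let _ : NormedSpace ℝ X := NormedSpace.restrictScalars ℝ ℂ X
    rw [← closure_ball (0 : X) hr.ne']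
    intro x hx
    exact le_on_closure hball (by fun_prop) (by fun_prop) hx
  have hψn : ‖ψ‖ ≤ b / r := ContinuousLinearMap.opNorm_bound_of_ball_bound hr b ψ hclosed
  have : RCLike.re (z ψ) ≤ b := calc
    RCLike.re (z ψ) ≤ ‖z ψ‖ := RCLike.re_le_norm _
    _ ≤ ‖z‖ * ‖ψ‖ := z.le_opNorm ψ
    _ ≤ r * (b / r) := by gcongr
    _ = b := by field_simp
  rw [hlz] at hbl
  exact absurd hbl this.not_gt

theorem exists_filter_tendsto_dual {r : ℝ} (hr : 0 < r) {z : StrongDual ℂ (StrongDual ℂ X)}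
    (hz : ‖z‖ ≤ r) : ∃ U : Filter X, U.NeBot ∧ Metric.ball (0 : X) r ∈ U ∧
      ∀ p : StrongDual ℂ X, Tendsto p U (𝓝 (z p)) := by
  refine ⟨comap (fun x (p : StrongDual ℂ X) => p x) (𝓝 fun p => z p) ⊓
    𝓟 (Metric.ball (0 : X) r), ?_, mem_inf_of_right (mem_principal_self _), fun p => ?_⟩
  · rw [inf_principal_neBot_iff]
    rintro s ⟨t, ht, hts⟩
    rw [nhds_pi, Filter.mem_pi] at ht
    obtain ⟨I, hI, w, hw, hwt⟩ := ht
    have := hI.to_subtype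
    have hcl := mem_closure_image_ball hr hz (fun i : I => (i : StrongDual ℂ X))
    obtain ⟨_, hy, x, hx, rfl⟩ := mem_closure_iff_nhds.1 hcl (Set.univ.pi fun i : I => w i)
      (set_pi_mem_nhds Set.finite_univ fun i _ => hw i)
    exact ⟨x, hts (hwt fun i hi => hy ⟨i, hi⟩ trivial), hx⟩
  · refine Tendsto.mono_left ?_ inf_le_left
    exact (continuous_apply p).tendsto (fun p : StrongDual ℂ X => z p) |>.comp tendsto_comap

/-! ### Second-order expansion of symmetric forms -/

theorem norm_map_add_smul_sub_le {n : ℕ}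
    (A : ContinuousMultilinearMap ℂ (fun _ : Fin (n + 1) => X) ℂ)
    (hA : ∀ v (σ : Equiv.Perm (Fin (n + 1))), A (v ∘ σ) = A v) {r : ℝ} {s x : X} {t : ℂ}
    (hs : ‖s‖ ≤ r) (hx : ‖x‖ ≤ r) (ht : ‖t‖ ≤ 1) :
    ‖A (fun _ => s + t • x) - A (fun _ => s) -
        (n + 1) * t * A (Fin.snoc (fun _ : Fin n => s) x)‖ ≤
      2 ^ (n + 1) * (‖A‖ * r ^ (n + 1)) * ‖t‖ ^ 2 := by
  classical
  have hr : 0 ≤ r := (norm_nonneg s).trans hs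
  have key := A.toMultilinearMap.map_add_eq_map_add_linearDeriv_add (fun _ => s) (fun _ => t • x)
  have hlin : A.toMultilinearMap.linearDeriv (fun _ => s) (fun _ => t • x) =
      (n + 1) * t * A (Fin.snoc (fun _ : Fin n => s) x) := by
    rw [MultilinearMap.linearDeriv_apply]
    have : ∀ i : Fin (n + 1), A.toMultilinearMap (Function.update (fun _ => s) i (t • x)) =
        t * A (Fin.snoc (fun _ : Fin n => s) x) := by
      intro i
      rw [MultilinearMap.map_update_smul, smul_eq_mul]
      congr 1
      rw [← hA (Fin.snoc (fun _ : Fin n => s) x) (Equiv.swap i (Fin.last n))]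
      refine congrArg A (funext fun j => ?_)
      have hsn : (Fin.snoc (fun _ : Fin n => s) x : Fin (n + 1) → X) =
          Function.update (fun _ => s) (Fin.last n) x := by
        ext j
        refine Fin.lastCases ?_ (fun k => ?_) j
        · simp
        · simp
      rw [Function.comp_apply, hsn]
      by_cases hj : j = i
      · subst hj; simp
      · rw [Function.update_of_ne hj, Function.update_of_ne]
        intro h
        apply hj
        rw [Equiv.swap_apply_eq_iff] at h
        simpa using h
    rw [Finset.sum_congr rfl fun i _ => this i]
    simp [mul_assoc]
  have hrest : A (fun _ => s + t • x) - A (fun _ => s) -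
        (n + 1) * t * A (Fin.snoc (fun _ : Fin n => s) x) =
      ∑ S : Finset (Fin (n + 1)) with 2 ≤ S.card, A (S.piecewise (fun _ => t • x) fun _ => s) := by
    rw [hlin] at key
    simp only [ContinuousMultilinearMap.coe_coe] at key
    have h2 : A (fun _ => s + t • x) = A ((fun _ => s) + fun _ => t • x) := rfl
    rw [h2, key]
    ring
  rw [hrest]
  have hterm : ∀ S ∈ Finset.univ.filter (fun S : Finset (Fin (n + 1)) => 2 ≤ S.card),
      ‖A (S.piecewise (fun _ => t • x) fun _ => s)‖ ≤ ‖A‖ * r ^ (n + 1) * ‖t‖ ^ 2 := by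
    intro S hS
    refine (A.le_opNorm _).trans ?_
    rw [mul_assoc]
    refine mul_le_mul_of_nonneg_left ?_ (norm_nonneg A)
    calc ∏ i, ‖S.piecewise (fun _ => t • x) (fun _ => s) i‖
        ≤ ∏ i, r * S.piecewise (fun _ => ‖t‖) (fun _ => 1) i := by
          refine Finset.prod_le_prod (fun _ _ => norm_nonneg _) fun i _ => ?_
          by_cases hi : i ∈ S
          · simp only [Finset.piecewise_eq_of_mem _ _ _ hi, norm_smul]
            rw [mul_comm r]
            gcongr
          · simpa [hi] using hs
      _ = r ^ (n + 1) * ‖t‖ ^ S.card := by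
          rw [Finset.prod_mul_distrib, Finset.prod_piecewise]
          simp
      _ ≤ r ^ (n + 1) * ‖t‖ ^ 2 := by
          refine mul_le_mul_of_nonneg_left ?_ (by positivity)
          exact pow_le_pow_of_le_one (norm_nonneg t) ht (by simpa using hS)
  refine (norm_sum_le_of_le _ hterm).trans ?_
  rw [Finset.sum_const, nsmul_eq_mul, mul_assoc (2 ^ (n + 1))]
  refine mul_le_mul_of_nonneg_right ?_ (by positivity)
  have h : (Finset.univ.filter (fun S : Finset (Fin (n + 1)) => 2 ≤ S.card)).card ≤ 2 ^ (n + 1) :=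
    (Finset.card_filter_le _ _).trans (by simp)
  exact_mod_cast h

/-- The scalar case of `norm_map_add_smul_sub_le`. -/
theorem exists_norm_pow_sub_le (n : ℕ) : ∃ D : ℝ, 0 ≤ D ∧ ∀ a t : ℂ, ‖a‖ ≤ 1 → ‖t‖ ≤ 1 →
    ‖(a + t) ^ (n + 1) - a ^ (n + 1) - (n + 1) * t * a ^ n‖ ≤ D * ‖t‖ ^ 2 := by
  refine ⟨2 ^ (n + 1) * (‖ContinuousMultilinearMap.mkPiAlgebraFin ℂ (n + 1) ℂ‖ * 1 ^ (n + 1)),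
    by positivity, fun a t ha ht => ?_⟩
  have h := norm_map_add_smul_sub_le (ContinuousMultilinearMap.mkPiAlgebraFin ℂ (n + 1) ℂ)
    (fun v σ => by
      simp only [ContinuousMultilinearMap.mkPiAlgebraFin_apply, List.prod_ofFn, Function.comp]
      exact Equiv.prod_comp σ v) (x := 1) ha (by simp) ht
  simpa only [ContinuousMultilinearMap.mkPiAlgebraFin_apply, List.prod_ofFn, Fin.prod_snoc,
    Finset.prod_const, Finset.card_univ, Fintype.card_fin, smul_eq_mul, mul_one] using h

/-! ### The Arens extension as a limit along averages -/

/-- The filter generated by the partial averages `(x₁ + ⋯ + xₖ) / N`, where the points `x₁, …, xₖ`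
tend one after the other along `U`, each limit being taken with the earlier points fixed. -/
def averageFilter (U : Filter X) (N : ℕ) : ℕ → Filter X
  | 0 => pure 0
  | k + 1 => (averageFilter U N k).bind fun s => U.map fun x => s + (N : ℂ)⁻¹ • x

theorem eventually_averageFilter_succ {U : Filter X} {N k : ℕ} {p : X → Prop} :
    (∀ᶠ y in averageFilter U N (k + 1), p y) ↔
      ∀ᶠ s in averageFilter U N k, ∀ᶠ x in U, p (s + (N : ℂ)⁻¹ • x) := by
  rw [averageFilter, eventually_bind]
  rfl

theorem neBot_bind {α β : Type*} {F : Filter α} {m : α → Filter β} [F.NeBot]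
    (hm : ∀ a, (m a).NeBot) : (F.bind m).NeBot := by
  rw [neBot_iff, Ne, ← eventually_false_iff_eq_bot, eventually_bind]
  simp [fun a => (hm a).ne, ‹F.NeBot›.ne]

instance (U : Filter X) [U.NeBot] (N k : ℕ) : (averageFilter U N k).NeBot := by
  induction k with
  | zero => exact pure_neBot
  | succ k ih => exact neBot_bind fun s => inferInstance

theorem eventually_norm_averageFilter_lt {U : Filter X} {r : ℝ} (hr : 0 < r)
    (hU : Metric.ball (0 : X) r ∈ U) {N : ℕ} {k : ℕ} (hk : k ≤ N) :
    ∀ᶠ s in averageFilter U N k, ‖s‖ ≤ k / N * r ∧ ‖s‖ < r := by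
  induction k with
  | zero => simp [averageFilter, hr]
  | succ k ih =>
    have hN : (0 : ℝ) < N := by exact_mod_cast (Nat.succ_pos k).trans_le hk
    have hkN : ((k : ℝ) + 1) / N ≤ 1 := by
      rw [div_le_one hN]; exact_mod_cast hk
    rw [eventually_averageFilter_succ]
    filter_upwards [ih (by omega)] with s hs
    filter_upwards [hU] with x hx
    have hx' : ‖x‖ < r := by simpa using hx
    have h : ‖s + (N : ℂ)⁻¹ • x‖ < ((k : ℝ) + 1) / N * r := calc
      ‖s + (N : ℂ)⁻¹ • x‖ ≤ ‖s‖ + (N : ℝ)⁻¹ * ‖x‖ := by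
        refine (norm_add_le _ _).trans_eq ?_
        rw [norm_smul, norm_inv, Complex.norm_natCast]
      _ < k / N * r + (N : ℝ)⁻¹ * r := by
        have := mul_lt_mul_of_pos_left hx' (inv_pos.2 hN)
        linarith [hs.1]
      _ = ((k : ℝ) + 1) / N * r := by ring
    refine ⟨by push_cast; exact h.le, h.trans_le ?_⟩
    exact mul_le_of_le_one_left hr.le hkN

/-- The extension of the last variable of a symmetric form is a symmetric form in the remaining
variables. -/
theorem comp_curryRight_perm {n : ℕ} {A : ContinuousMultilinearMap ℂ (fun _ : Fin (n + 1) => X) ℂ}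
    (hA : ∀ v (σ : Equiv.Perm (Fin (n + 1))), A (v ∘ σ) = A v)
    (z : StrongDual ℂ (StrongDual ℂ X)) (v : Fin n → X) (σ : Equiv.Perm (Fin n)) :
    z.compContinuousMultilinearMap A.curryRight (v ∘ σ) =
      z.compContinuousMultilinearMap A.curryRight v := by
  simp only [ContinuousLinearMap.compContinuousMultilinearMap_coe, Function.comp_apply]
  congr 1
  ext x
  rw [ContinuousMultilinearMap.curryRight_apply, ContinuousMultilinearMap.curryRight_apply]
  obtain ⟨τ, hτ, hτ'⟩ : ∃ τ : Equiv.Perm (Fin (n + 1)),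
      (∀ i : Fin n, τ i.castSucc = (σ i).castSucc) ∧ τ (Fin.last n) = Fin.last n := by
    refine ⟨(finSuccEquivLast (n := n)).symm.permCongr σ.optionCongr, fun i => ?_, ?_⟩ <;>
      simp [Equiv.permCongr_apply]
  rw [← hA (Fin.snoc v x) τ]
  refine congrArg A (funext fun j => ?_)
  refine Fin.lastCases ?_ (fun k => ?_) j
  · simp [hτ']
  · simp [hτ]

/-- The recursion behind the Davie-Gamelin theorem: if the points tend to `z` weak-star along `U`,
then on the average of `k` of them, scaled by `k / N`, a symmetric `n`-homogeneous form differs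
from `(k / N) ^ n` times its extension at `z` by `O(k / N ^ 2)`. -/
theorem exists_eventually_norm_sub_arensExtension_le {U : Filter X} {r : ℝ} (hr : 0 < r)
    (hU : Metric.ball (0 : X) r ∈ U) {z : StrongDual ℂ (StrongDual ℂ X)}
    (hUz : ∀ p : StrongDual ℂ X, Tendsto p U (𝓝 (z p))) {n : ℕ}
    (A : ContinuousMultilinearMap ℂ (fun _ : Fin n => X) ℂ)
    (hA : ∀ v (σ : Equiv.Perm (Fin n)), A (v ∘ σ) = A v) :
    ∃ C : ℝ, 0 ≤ C ∧ ∀ N : ℕ, 0 < N → ∀ k ≤ N, ∀ᶠ s in averageFilter U N k,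
      ‖A (fun _ => s) - ((k : ℂ) / N) ^ n * arensExtension n A (fun _ => z)‖ ≤
        C * k / (N : ℝ) ^ 2 := by
  induction n with
  | zero =>
    refine ⟨0, le_rfl, fun N _ k _ => Eventually.of_forall fun s => ?_⟩
    have : (fun _ : Fin 0 => s) = 0 := Subsingleton.elim _ _
    simp [arensExtension, this]
  | succ n ihn =>
    obtain ⟨C, hC, ih⟩ := ihn (z.compContinuousMultilinearMap A.curryRight)
      (comp_curryRight_perm hA z)
    obtain ⟨D, hD, hpow⟩ := exists_norm_pow_sub_le n
    set c := arensExtension (n + 1) A (fun _ => z) with hc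
    have hc' : arensExtension n (z.compContinuousMultilinearMap A.curryRight) (fun _ => z) = c :=
      rfl
    set E : ℝ := 2 ^ (n + 1) * (‖A‖ * r ^ (n + 1)) with hE
    have hE0 : 0 ≤ E := by positivity
    refine ⟨(n + 1) + (n + 1) * C + E + ‖c‖ * D, by positivity, fun N hN k => ?_⟩
    have hN' : (0 : ℝ) < N := by exact_mod_cast hN
    have hN1 : (1 : ℝ) ≤ N := by exact_mod_cast hN
    have ht : ‖(N : ℂ)⁻¹‖ = (N : ℝ)⁻¹ := by rw [norm_inv, Complex.norm_natCast]
    have ht1 : ‖(N : ℂ)⁻¹‖ ≤ 1 := by rw [ht]; exact inv_le_one_of_one_le₀ hN1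
    have hNc : (N : ℂ) ≠ 0 := by exact_mod_cast hN.ne'
    induction k with
    | zero =>
      intro _
      have : A (fun _ => (0 : X)) = 0 := A.map_coord_zero 0 rfl
      simp [averageFilter, this]
    | succ k ihk =>
      intro hk
      rw [eventually_averageFilter_succ]
      filter_upwards [ihk (by omega), ih N hN k (by omega),
        eventually_norm_averageFilter_lt hr hU (show k ≤ N by omega)] with s h1 h2 h3
      rw [hc'] at h2
      have hlim := hUz (A.curryRight fun _ : Fin n => s)
      filter_upwards [hU, (Metric.tendsto_nhds.1 hlim) (N : ℝ)⁻¹ (inv_pos.2 hN')] with x hx h4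
      have hx' : ‖x‖ ≤ r := by simpa using (mem_ball_zero_iff.1 hx).le
      rw [dist_eq_norm, ContinuousMultilinearMap.curryRight_apply] at h4
      have h5 := norm_map_add_smul_sub_le A hA h3.2.le hx' ht1
      have hkN : (k : ℝ) / N ≤ 1 := by
        rw [div_le_one hN']; exact_mod_cast (by omega : k ≤ N)
      have h6 := hpow ((k : ℂ) / N) (N : ℂ)⁻¹ (by simpa using hkN) ht1
      rw [ht] at h5 h6
      set a := z (A.curryRight fun _ : Fin n => s) with ha
      have ha' : z.compContinuousMultilinearMap A.curryRight (fun _ => s) = a := rfl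
      rw [ha'] at h2
      set y := A (Fin.snoc (fun _ : Fin n => s) x)
      have hsplit : A (fun _ => s + (N : ℂ)⁻¹ • x) - (((k + 1 : ℕ) : ℂ) / N) ^ (n + 1) * c =
          (A (fun _ => s) - ((k : ℂ) / N) ^ (n + 1) * c) +
          (n + 1) * (N : ℂ)⁻¹ * (y - a) +
          (n + 1) * (N : ℂ)⁻¹ * (a - ((k : ℂ) / N) ^ n * c) +
          (A (fun _ => s + (N : ℂ)⁻¹ • x) - A (fun _ => s) - (n + 1) * (N : ℂ)⁻¹ * y) -
          c * (((k : ℂ) / N + (N : ℂ)⁻¹) ^ (n + 1) - ((k : ℂ) / N) ^ (n + 1) -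
            (n + 1) * (N : ℂ)⁻¹ * ((k : ℂ) / N) ^ n) := by
        have : (((k + 1 : ℕ) : ℂ) / N) = (k : ℂ) / N + (N : ℂ)⁻¹ := by
          push_cast; rw [add_div, one_div]
        rw [this]
        ring
      have hn1 : ‖((n : ℂ) + 1) * (N : ℂ)⁻¹‖ = (n + 1) * (N : ℝ)⁻¹ := by
        rw [norm_mul, ht]
        congr 1
        exact_mod_cast Complex.norm_natCast (n + 1)
      have hCk : C * k / (N : ℝ) ^ 2 ≤ C * (N : ℝ)⁻¹ := calc
        C * k / (N : ℝ) ^ 2 = C * (N : ℝ)⁻¹ * (k / N) := by field_simp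
        _ ≤ C * (N : ℝ)⁻¹ := mul_le_of_le_one_right (by positivity) hkN
      rw [hsplit]
      calc _ ≤ ((n + 1) + (n + 1) * C + E + ‖c‖ * D) * k / (N : ℝ) ^ 2 +
            (n + 1) * (N : ℝ)⁻¹ * (N : ℝ)⁻¹ + (n + 1) * (N : ℝ)⁻¹ * (C * (N : ℝ)⁻¹) +
            E * (N : ℝ)⁻¹ ^ 2 + ‖c‖ * (D * (N : ℝ)⁻¹ ^ 2) := by
            refine (norm_sub_le _ _).trans (add_le_add ((norm_add_le _ _).trans (add_le_add
              ((norm_add_le _ _).trans (add_le_add ((norm_add_le _ _).trans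
                (add_le_add h1 ?_)) ?_)) h5)) ?_)
            · rw [norm_mul, hn1]; gcongr
            · rw [norm_mul, hn1]; gcongr; exact h2.trans hCk
            · rw [norm_mul]; gcongr
        _ = _ := by push_cast; field_simp; ring

/-- Every point of the closed ball of radius `r` of the bidual is the limit, along one filter on the
open ball of radius `r` of `X`, of all continuous homogeneous polynomials simultaneously. -/
theorem exists_filter_tendsto_arensExtension {r : ℝ} (hr : 0 < r)
    {z : StrongDual ℂ (StrongDual ℂ X)} (hz : ‖z‖ ≤ r) :
    ∃ G : Filter X, G.NeBot ∧ Metric.ball (0 : X) r ∈ G ∧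
      ∀ (n : ℕ) (A : ContinuousMultilinearMap ℂ (fun _ : Fin n => X) ℂ),
        (∀ v (σ : Equiv.Perm (Fin n)), A (v ∘ σ) = A v) →
        Tendsto (fun x => A fun _ => x) G (𝓝 (arensExtension n A fun _ => z)) := by
  obtain ⟨U, hne, hU, hUz⟩ := exists_filter_tendsto_dual hr hz
  refine ⟨(atTop : Filter ℕ).bind fun N => averageFilter U N N, neBot_bind fun N => inferInstance,
    ?_, fun n A hA => ?_⟩
  · change ∀ᶠ x in _, x ∈ Metric.ball (0 : X) r
    rw [eventually_bind]
    refine Eventually.of_forall fun N => ?_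
    filter_upwards [eventually_norm_averageFilter_lt hr hU le_rfl] with s hs
    simpa using hs.2
  · obtain ⟨C, hC, h⟩ := exists_eventually_norm_sub_arensExtension_le hr hU hUz A hA
    rw [Metric.tendsto_nhds]
    intro ε hε
    rw [eventually_bind]
    have hlim : Tendsto (fun N : ℕ => C / (N : ℝ)) atTop (𝓝 0) :=
      tendsto_const_div_atTop_nhds_zero_nat C
    filter_upwards [hlim.eventually_lt_const hε, eventually_gt_atTop 0] with N hN hN0
    filter_upwards [h N hN0 N le_rfl] with s hs
    have hNc : (N : ℂ) ≠ 0 := by exact_mod_cast hN0.ne'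
    have hNr : (N : ℝ) ≠ 0 := by exact_mod_cast hN0.ne'
    rw [div_self hNc, one_pow, one_mul] at hs
    rw [dist_eq_norm]
    refine hs.trans_lt (lt_of_eq_of_lt ?_ hN)
    field_simp

/-! ### Cauchy estimates and Taylor series -/

theorem norm_fderiv_le_of_forall_norm_le {F : Type*} [NormedAddCommGroup F] [NormedSpace ℂ F]
    {g : X → F} (hg : Differentiable ℂ g) {ρ δ M : ℝ} (hδ : 0 < δ)
    (hM : ∀ y, ‖y‖ ≤ ρ + δ → ‖g y‖ ≤ M) {x : X} (hx : ‖x‖ ≤ ρ) : ‖fderiv ℂ g x‖ ≤ M / δ := by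
  have hM0 : 0 ≤ M := (norm_nonneg _).trans (hM x (by linarith))
  refine ContinuousLinearMap.opNorm_le_bound _ (by positivity) fun v => ?_
  rcases eq_or_ne v 0 with rfl | hv
  · simp
  have hv' : 0 < ‖v‖ := norm_pos_iff.2 hv
  have hline : Differentiable ℂ fun t : ℂ => g (x + t • v) := by fun_prop
  have hderiv : deriv (fun t : ℂ => g (x + t • v)) 0 = fderiv ℂ g x v := by
    have h1 : HasFDerivAt g (fderiv ℂ g x) (x + (0 : ℂ) • v) := by
      simpa using (hg x).hasFDerivAt
    have h2 : HasDerivAt (fun t : ℂ => x + t • v) v 0 := by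
      simpa using ((hasDerivAt_id (0 : ℂ)).smul_const v).const_add x
    exact (h1.comp_hasDerivAt (0 : ℂ) h2).deriv
  have h := Complex.norm_deriv_le_of_forall_mem_sphere_norm_le (c := 0) (R := δ / ‖v‖) (C := M)
    (by positivity) hline.diffContOnCl fun t ht => by
      refine hM _ ((norm_add_le _ _).trans ?_)
      rw [mem_sphere_zero_iff_norm] at ht
      rw [norm_smul, ht, div_mul_cancel₀ _ hv'.ne']
      linarith
  rw [hderiv] at h
  refine h.trans_eq ?_
  field_simp

/-- Cauchy estimate for the `m`-th derivative at `0`: apply the first order estimate `m` times, each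
time on a ball whose radius is smaller by `δ`. -/
theorem norm_iteratedFDeriv_zero_le {f : X → ℂ} (hf : ContDiff ℂ ⊤ f) {δ M : ℝ} (hδ : 0 < δ) (m : ℕ)
    (hM : ∀ y, ‖y‖ ≤ m * δ → ‖f y‖ ≤ M) : ‖iteratedFDeriv ℂ m f 0‖ ≤ M / δ ^ m := by
  have key : ∀ k ≤ m, ∀ y : X, ‖y‖ ≤ (m - k : ℕ) * δ → ‖iteratedFDeriv ℂ k f y‖ ≤ M / δ ^ k := by
    intro k
    induction k with
    | zero => intro _ y hy; simpa using hM y (by simpa using hy)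
    | succ k ih =>
      intro hk y hy
      rw [← norm_fderiv_iteratedFDeriv, pow_succ, ← div_div]
      refine norm_fderiv_le_of_forall_norm_le
        (hf.differentiable_iteratedFDeriv (by exact_mod_cast WithTop.coe_lt_top _)) hδ
        (fun w hw => ih (by omega) w (hw.trans_eq ?_)) hy
      have : ((m - k : ℕ) : ℝ) = (m - (k + 1) : ℕ) + 1 := by
        rw [← Nat.cast_add_one]; congr 1; omega
      rw [this]; ring
  exact key m le_rfl 0 (by simp)

theorem arensExtension_smul (c : ℂ) {n : ℕ} (A : ContinuousMultilinearMap ℂ (fun _ : Fin n => X) ℂ)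
    (z : Fin n → StrongDual ℂ (StrongDual ℂ X)) :
    arensExtension n (c • A) z = c * arensExtension n A z := by
  induction n with
  | zero => simp [arensExtension]
  | succ n ih =>
    rw [arensExtension, arensExtension, ← ih]
    congr 1
    ext v
    simp only [ContinuousLinearMap.compContinuousMultilinearMap_coe, Function.comp_apply,
      _root_.smul_apply]
    rw [← map_smul]
    congr 1

theorem arensExtension_inclusionInDoubleDual {n : ℕ}
    (A : ContinuousMultilinearMap ℂ (fun _ : Fin n => X) ℂ) (x : Fin n → X) :
    arensExtension n A (fun i => NormedSpace.inclusionInDoubleDual ℂ X (x i)) = A x := by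
  induction n with
  | zero => exact congrArg A (Subsingleton.elim _ _)
  | succ n ih =>
    rw [arensExtension]
    refine (ih _ (Fin.init x)).trans ?_
    simp [Fin.snoc_init_self]

namespace Hb

theorem contDiff (f : Hb X) : ContDiff ℂ ⊤ (f : X → ℂ) := AnalyticOnNhd.contDiff f.2.1

theorem exists_norm_le (f : Hb X) (R : ℝ) : ∃ M, 0 ≤ M ∧ ∀ x, ‖x‖ ≤ R → ‖f x‖ ≤ M := by
  obtain ⟨M, hM⟩ := (f.2.2 (Metric.closedBall 0 R) Metric.isBounded_closedBall).exists_norm_le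
  exact ⟨max M 0, le_max_right _ _, fun x hx =>
    (hM _ ⟨x, by simpa using hx, rfl⟩).trans (le_max_left _ _)⟩

/-- The `m`-th Taylor coefficient of `f` at `0`, a symmetric `m`-linear form. -/
def taylorForm (f : Hb X) (m : ℕ) : ContinuousMultilinearMap ℂ (fun _ : Fin m => X) ℂ :=
  (m.factorial : ℂ)⁻¹ • iteratedFDeriv ℂ m f 0

theorem taylorForm_perm (f : Hb X) (m : ℕ) (v : Fin m → X) (σ : Equiv.Perm (Fin m)) :
    f.taylorForm m (v ∘ σ) = f.taylorForm m v := by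
  simp only [taylorForm, _root_.smul_apply]
  rw [f.contDiff.contDiffAt.iteratedFDeriv_comp_perm]

theorem summable_norm_taylorForm (f : Hb X) {r : ℝ} (hr : 0 < r) :
    Summable fun m => ‖f.taylorForm m‖ * r ^ m := by
  -- The estimate on the ball of radius `2 * e * r` gives `M / 2 ^ m`, since `m ^ m / m! ≤ e ^ m`.
  obtain ⟨M, hM0, hM⟩ := f.exists_norm_le (2 * Real.exp 1 * r)
  refine Summable.of_nonneg_of_le (fun m => by positivity) (fun m => ?_)
    ((summable_geometric_two).mul_left M)
  rcases Nat.eq_zero_or_pos m with rfl | hm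
  · have := norm_iteratedFDeriv_zero_le f.contDiff one_pos 0
      (fun y hy => hM y (hy.trans (by simp; positivity)))
    simpa [taylorForm] using this
  have hm' : (0 : ℝ) < m := by exact_mod_cast hm
  set δ : ℝ := 2 * Real.exp 1 * r / m with hδ
  have hδ0 : 0 < δ := by positivity
  have h1 := norm_iteratedFDeriv_zero_le f.contDiff hδ0 m
    (fun y hy => hM y (hy.trans_eq (by rw [hδ]; field_simp)))
  have h2 : (m : ℝ) ^ m / m.factorial ≤ Real.exp 1 ^ m := by
    rw [← Real.exp_nat_mul, mul_one]
    exact Real.pow_div_factorial_le_exp m hm'.le m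
  calc ‖f.taylorForm m‖ * r ^ m
      = (m.factorial : ℝ)⁻¹ * ‖iteratedFDeriv ℂ m f 0‖ * r ^ m := by
        rw [taylorForm, norm_smul, norm_inv, Complex.norm_natCast]
    _ ≤ (m.factorial : ℝ)⁻¹ * (M / δ ^ m) * r ^ m := by gcongr
    _ = M * ((m : ℝ) ^ m / m.factorial) * (1 / (2 * Real.exp 1)) ^ m := by
        rw [hδ]; simp only [div_pow, mul_pow]; field_simp; rw [one_pow, mul_one]
    _ ≤ M * Real.exp 1 ^ m * (1 / (2 * Real.exp 1)) ^ m := by gcongr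
    _ = M * (1 / 2) ^ m := by rw [mul_assoc, ← mul_pow]; congr 2; field_simp

theorem norm_taylorForm_apply_le (f : Hb X) (m : ℕ) {r : ℝ} {x : X} (hx : ‖x‖ ≤ r) :
    ‖f.taylorForm m fun _ => x‖ ≤ ‖f.taylorForm m‖ * r ^ m := by
  refine ((f.taylorForm m).le_opNorm _).trans ?_
  rw [Finset.prod_const, Finset.card_univ, Fintype.card_fin]
  gcongr

theorem hasSum_taylorForm (f : Hb X) (x : X) :
    HasSum (fun m => f.taylorForm m fun _ => x) (f x) := by
  set L : ℂ →L[ℂ] X := ContinuousLinearMap.toSpanSingleton ℂ x with hL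
  have hd : Differentiable ℂ ((f : X → ℂ) ∘ L) :=
    (f.contDiff.differentiable (by simp)).comp L.differentiable
  have h := Complex.hasSum_taylorSeries_of_entire hd 0 1
  simp only [sub_zero, one_pow, one_smul, Function.comp_apply, hL,
    ContinuousLinearMap.toSpanSingleton_apply] at h
  have hterm : (fun m => f.taylorForm m fun _ => x) = fun m : ℕ => (m.factorial : ℂ)⁻¹ •
      iteratedDeriv m ((f : X → ℂ) ∘ ContinuousLinearMap.toSpanSingleton ℂ x) 0 := by
    funext m
    rw [iteratedDeriv_eq_iteratedFDeriv, ContinuousLinearMap.iteratedFDeriv_comp_right _ f.contDiff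
      _ (by exact_mod_cast le_top)]
    simp [taylorForm]
  rw [hterm]
  exact h

theorem aronBernerTerm_eq (f : Hb X) (z : StrongDual ℂ (StrongDual ℂ X)) (m : ℕ) :
    aronBernerTerm f z m = arensExtension m (f.taylorForm m) fun _ => z := by
  rw [aronBernerTerm, taylorForm, arensExtension_smul]

end Hb

theorem IsPolynomial.exists_coe_eq {P : X → ℂ} (hP : IsPolynomial P) :
    ∃ g : Hb X, (g : X → ℂ) = P := by
  obtain ⟨n, A, hA⟩ := hP
  have hform : ∀ k, (fun x => A k fun _ => x) ∈ entireBoundedType X := by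
    refine fun k => ⟨fun x _ => ?_, fun s hs => ?_⟩
    · have hdiag : AnalyticAt ℂ (fun (x : X) (_ : Fin k) => x) x :=
        (ContinuousLinearMap.pi fun _ : Fin k => ContinuousLinearMap.id ℂ X).analyticAt x
      exact (A k).analyticAt.comp hdiag
    · obtain ⟨C, hC⟩ := hs.exists_norm_le
      refine isBounded_iff_forall_norm_le.2 ⟨‖A k‖ * C ^ k, ?_⟩
      rintro _ ⟨x, hx, rfl⟩
      refine ((A k).le_opNorm _).trans ?_
      rw [Finset.prod_const, Finset.card_univ, Fintype.card_fin]
      gcongr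
      exact hC x hx
  refine ⟨⟨∑ k ∈ Finset.range n, fun x => A k fun _ => x, sum_mem fun k _ => hform k⟩, ?_⟩
  funext x
  rw [hA]
  exact Finset.sum_apply x (Finset.range n) fun k (x : X) => A k fun _ => x

namespace Hb

theorem exists_isPolynomial_norm_sub_le (f : Hb X) {r : ℝ} (hr : 0 < r) {ε : ℝ} (hε : 0 < ε) :
    ∃ g : Hb X, IsPolynomial (g : X → ℂ) ∧ ∀ x ∈ Metric.ball (0 : X) r, ‖f x - g x‖ ≤ ε := by
  have hunif := tendstoUniformlyOn_tsum_nat (f := fun m (x : X) => f.taylorForm m fun _ => x)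
    (f.summable_norm_taylorForm hr) (s := Metric.ball (0 : X) r)
    fun m x hx => f.norm_taylorForm_apply_le m (mem_ball_zero_iff.1 hx).le
  obtain ⟨N, hN⟩ := (Metric.tendstoUniformlyOn_iff.1 hunif ε hε).exists
  have hpoly : IsPolynomial fun x => ∑ m ∈ Finset.range N, f.taylorForm m fun _ => x :=
    ⟨N, f.taylorForm, fun _ => rfl⟩
  obtain ⟨g, hg⟩ := hpoly.exists_coe_eq
  refine ⟨g, hg ▸ hpoly, fun x hx => ?_⟩
  have := hN x hx
  rw [(f.hasSum_taylorForm x).tsum_eq, dist_eq_norm] at this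
  rw [hg]
  exact this.le

/-! ### The Aron-Berner extension as a limit -/

theorem aronBerner_inclusionInDoubleDual (f : Hb X) (x : X) :
    aronBerner f (NormedSpace.inclusionInDoubleDual ℂ X x) = f x := by
  rw [aronBerner, ← (f.hasSum_taylorForm x).tsum_eq]
  refine tsum_congr fun m => ?_
  rw [aronBernerTerm_eq]
  exact arensExtension_inclusionInDoubleDual _ _

theorem summable_aronBernerTerm (f : Hb X) (z : StrongDual ℂ (StrongDual ℂ X)) :
    Summable (aronBernerTerm f z) := by
  have hr : 0 < ‖z‖ + 1 := by positivity
  obtain ⟨G, _, hball, hG⟩ := exists_filter_tendsto_arensExtension hr (z := z) (by linarith)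
  refine Summable.of_norm_bounded (f.summable_norm_taylorForm hr) fun m => ?_
  rw [aronBernerTerm_eq]
  refine le_of_tendsto (hG m _ (f.taylorForm_perm m)).norm ?_
  filter_upwards [hball] with x hx
  exact f.norm_taylorForm_apply_le m (mem_ball_zero_iff.1 hx).le

end Hb

/-- The Davie-Gamelin theorem for entire functions of bounded type: every point of the closed ball
of radius `r` of the bidual is the limit of a filter on the open ball of radius `r` of `X` along
which each such function tends to the value of its Aron-Berner extension. -/
theorem exists_filter_tendsto_aronBerner {r : ℝ} (hr : 0 < r)
    {z : StrongDual ℂ (StrongDual ℂ X)} (hz : ‖z‖ ≤ r) :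
    ∃ G : Filter X, G.NeBot ∧ Metric.ball (0 : X) r ∈ G ∧
      ∀ f : Hb X, Tendsto f G (𝓝 (aronBerner f z)) := by
  obtain ⟨G, hne, hball, hG⟩ := exists_filter_tendsto_arensExtension hr hz
  refine ⟨G, hne, hball, fun f => ?_⟩
  have h : Tendsto (fun x => ∑' m, f.taylorForm m fun _ => x) G
      (𝓝 (∑' m, aronBernerTerm f z m)) := by
    refine tendsto_tsum_of_dominated_convergence (f.summable_norm_taylorForm hr) (fun m => ?_) ?_
    · rw [Hb.aronBernerTerm_eq]
      exact hG m _ (f.taylorForm_perm m)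
    · filter_upwards [hball] with x hx m
      exact f.norm_taylorForm_apply_le m (mem_ball_zero_iff.1 hx).le
  exact h.congr fun x => (f.hasSum_taylorForm x).tsum_eq

section Evaluation

variable {r : ℝ} {z : StrongDual ℂ (StrongDual ℂ X)}

theorem norm_aronBerner_le (hr : 0 < r) (hz : ‖z‖ ≤ r) {f : Hb X} {M : ℝ}
    (hM : ∀ x ∈ Metric.ball (0 : X) r, ‖f x‖ ≤ M) : ‖aronBerner f z‖ ≤ M := by
  obtain ⟨G, _, hball, hG⟩ := exists_filter_tendsto_aronBerner hr hz
  exact le_of_tendsto (hG f).norm (by filter_upwards [hball] with x hx using hM x hx)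

/-- The Aron-Berner extension at `z` as an algebra homomorphism. Multiplicativity is that of limits
along the filter of the Davie-Gamelin theorem. -/
theorem exists_algHom_eq_aronBerner (z : StrongDual ℂ (StrongDual ℂ X)) :
    ∃ e : Hb X →ₐ[ℂ] ℂ, ∀ f, e f = aronBerner f z := by
  obtain ⟨G, _, -, hG⟩ := exists_filter_tendsto_aronBerner (r := ‖z‖ + 1) (by positivity)
    (z := z) (by linarith)
  refine ⟨AlgHom.ofLinearMap
    { toFun := fun f => aronBerner f z
      map_add' := fun f g => tendsto_nhds_unique (hG (f + g)) ((hG f).add (hG g))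
      map_smul' := fun c f => tendsto_nhds_unique (hG (c • f)) ((hG f).const_mul c) }
    (tendsto_nhds_unique (hG 1) tendsto_const_nhds)
    (fun f g => tendsto_nhds_unique (hG (f * g)) ((hG f).mul (hG g))), fun f => rfl⟩

theorem aronBerner_sub (f g : Hb X) (z : StrongDual ℂ (StrongDual ℂ X)) :
    aronBerner (f - g : Hb X) z = aronBerner f z - aronBerner g z := by
  obtain ⟨e, he⟩ := exists_algHom_eq_aronBerner z
  simp only [← he, map_sub]

/-- A number that the polynomials near `f` on the ball approximate as well as they approximate `f`
is the value of the Aron-Berner extension of `f`, since polynomials are dense. -/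
theorem eq_aronBerner_of_forall_isPolynomial (hr : 0 < r) (hz : ‖z‖ ≤ r) {f : Hb X} {l : ℂ}
    (h : ∀ (g : Hb X) (ε : ℝ), IsPolynomial (g : X → ℂ) →
      (∀ x ∈ Metric.ball (0 : X) r, ‖f x - g x‖ ≤ ε) → ‖l - aronBerner g z‖ ≤ ε) :
    l = aronBerner f z := by
  rw [← sub_eq_zero, ← norm_le_zero_iff]
  refine le_of_forall_pos_le_add fun ε hε => ?_
  obtain ⟨g, hgP, hg⟩ := f.exists_isPolynomial_norm_sub_le hr (half_pos hε)
  have h1 := h g _ hgP hg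
  have h2 : ‖aronBerner (f - g : Hb X) z‖ ≤ ε / 2 := norm_aronBerner_le hr hz hg
  rw [aronBerner_sub] at h2
  calc ‖l - aronBerner f z‖
      = ‖(l - aronBerner g z) - (aronBerner f z - aronBerner g z)‖ := by congr 1; ring
    _ ≤ ε / 2 + ε / 2 := (norm_sub_le _ _).trans (add_le_add h1 h2)
    _ = 0 + ε := by ring

/-! ### Cluster sets and fibers -/

theorem tendsto_nhds_polynomialStarTopology_iff {ι : Type*} {F : Filter ι} {x : ι → X} :
    Tendsto (fun a => NormedSpace.inclusionInDoubleDual ℂ X (x a)) F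
        (@nhds _ (polynomialStarTopology X) z) ↔
      ∀ g : Hb X, IsPolynomial (g : X → ℂ) → Tendsto (fun a => g (x a)) F (𝓝 (aronBerner g z)) := by
  simp only [nhds_iInf, nhds_induced, tendsto_iInf, tendsto_comap_iff]
  constructor
  · intro h g hg
    exact (h g hg).congr fun a => g.aronBerner_inclusionInDoubleDual (x a)
  · intro h P hP
    obtain ⟨g, rfl⟩ := hP.exists_coe_eq
    exact (h g hP).congr fun a => (g.aronBerner_inclusionInDoubleDual (x a)).symm

theorem clusterSet_eq_singleton (hr : 0 < r) (hz : ‖z‖ ≤ r) (f : Hb X) :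
    clusterSet r f z = {aronBerner f z} := by
  refine Set.eq_singleton_iff_unique_mem.2 ⟨?_, ?_⟩
  · obtain ⟨G, hne, hball, hG⟩ := exists_filter_tendsto_aronBerner hr hz
    -- The net picks a point of the ball in each member of `G`, ordered by reverse inclusion.
    have hex : ∀ s : {s : Set X // s ∈ G}, ∃ x, x ∈ s.1 ∩ Metric.ball (0 : X) r := fun s =>
      G.nonempty_of_mem (inter_mem s.2 hball)
    choose x hx using hex
    have hdir : IsDirectedOrder {s : Set X // s ∈ G}ᵒᵈ :=
      ⟨fun s t => ⟨OrderDual.toDual ⟨_, inter_mem (OrderDual.ofDual s).2 (OrderDual.ofDual t).2⟩,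
        Set.inter_subset_left, Set.inter_subset_right⟩⟩
    have hnonempty : Nonempty {s : Set X // s ∈ G}ᵒᵈ := ⟨OrderDual.toDual ⟨_, univ_mem⟩⟩
    have hlim : Tendsto (fun a : {s : Set X // s ∈ G}ᵒᵈ => x (OrderDual.ofDual a)) atTop G := by
      intro s hs
      refine mem_atTop_sets.2 ⟨OrderDual.toDual ⟨s, hs⟩, fun t ht => ?_⟩
      exact ht (hx (OrderDual.ofDual t)).1
    refine ⟨{s : Set X // s ∈ G}ᵒᵈ, inferInstance, hdir, hnonempty, fun a => x (OrderDual.ofDual a),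
      fun a => (hx _).2, ?_, (hG f).comp hlim⟩
    exact tendsto_nhds_polynomialStarTopology_iff.2 fun g _ => (hG g).comp hlim
  · rintro l ⟨ι, _, _, _, x, hx, hxz, hl⟩
    refine eq_aronBerner_of_forall_isPolynomial hr hz fun g ε hg hfg => ?_
    have hgx := tendsto_nhds_polynomialStarTopology_iff.1 hxz g hg
    exact le_of_tendsto (hl.sub hgx).norm (Eventually.of_forall fun a => hfg _ (hx a))

theorem Hb.continuous_of_norm_le_ball {e : Hb X →ₐ[ℂ] ℂ}
    (he : ∀ (f : Hb X) (M : ℝ), (∀ x ∈ Metric.ball (0 : X) r, ‖f x‖ ≤ M) → ‖e f‖ ≤ M) :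
    Continuous e := by
  refine continuous_iff_continuousAt.2 fun f => Metric.tendsto_nhds.2 fun ε hε => ?_
  have hid : Tendsto (fun g : Hb X =>
      UniformOnFun.ofFun {s : Set X | Bornology.IsBounded s} (g : X → ℂ)) (𝓝 f)
      (𝓝 (UniformOnFun.ofFun {s : Set X | Bornology.IsBounded s} (f : X → ℂ))) :=
    continuous_induced_dom.tendsto f
  have hunif := UniformOnFun.tendsto_iff_tendstoUniformlyOn.1 hid (Metric.ball 0 r)
    Metric.isBounded_ball
  filter_upwards [Metric.tendstoUniformlyOn_iff.1 hunif (ε / 2) (half_pos hε)] with g hg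
  rw [dist_eq_norm, ← map_sub]
  refine (he (g - f) (ε / 2) fun x hx => ?_).trans_lt (half_lt_self hε)
  have := hg x hx
  rw [dist_comm, dist_eq_norm] at this
  exact this.le

theorem Hb.norm_le_iSup_ball (f : Hb X) {x : X} (hx : x ∈ Metric.ball (0 : X) r) :
    ‖f x‖ ≤ ⨆ y : Metric.ball (0 : X) r, ‖f y‖ := by
  obtain ⟨M, -, hM⟩ := f.exists_norm_le r
  refine le_ciSup (f := fun y : Metric.ball (0 : X) r => ‖f y‖) ⟨M, ?_⟩ ⟨x, hx⟩
  rintro _ ⟨y, rfl⟩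
  exact hM y (mem_ball_zero_iff.1 y.2).le

theorem gelfandTransform_image_fiber (hr : 0 < r) (hz : ‖z‖ ≤ r) (f : Hb X) :
    WeakDual.gelfandTransform ℂ (Hb X) f '' fiber z r = {aronBerner f z} := by
  refine Set.eq_singleton_iff_unique_mem.2 ⟨?_, ?_⟩
  · obtain ⟨e, he⟩ := exists_algHom_eq_aronBerner z
    have hcont : Continuous e := Hb.continuous_of_norm_le_ball (r := r) fun f M hM => by
      rw [he]; exact norm_aronBerner_le hr hz hM
    let w : WeakDual ℂ (Hb X) := StrongDual.toWeakDual ⟨e.toLinearMap, hcont⟩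
    have hw : ∀ g : Hb X, w g = e g := fun _ => rfl
    have hmem : w ∈ WeakDual.characterSpace ℂ (Hb X) := by
      refine ⟨fun h0 => one_ne_zero (α := ℂ) ?_, fun g h => map_mul e g h⟩
      rw [← map_one e, ← hw, h0]
      rfl
    refine ⟨⟨w, hmem⟩, ⟨fun g _ => he g, fun g => ?_⟩, he f⟩
    change ‖e g‖ ≤ _
    rw [he]
    exact norm_aronBerner_le hr hz fun x hx => g.norm_le_iSup_ball hx
  · rintro _ ⟨φ, ⟨hP, hsup⟩, rfl⟩
    rw [WeakDual.gelfandTransform_apply_apply]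
    refine eq_aronBerner_of_forall_isPolynomial hr hz fun g ε hg hfg => ?_
    rw [← hP g hg, ← map_sub]
    have : Nonempty (Metric.ball (0 : X) r) := ⟨⟨0, Metric.mem_ball_self hr⟩⟩
    exact (hsup (f - g)).trans (ciSup_le fun x => hfg x x.2)

end Evaluation

end ClusterValue

end

theorem mainTheorem4 (X : Type u) [NormedAddCommGroup X] [NormedSpace ℂ X] [CompleteSpace X]
    (r : ℝ) (hr : 0 < r) (f : ClusterValue.Hb X) (z : StrongDual ℂ (StrongDual ℂ X))
    (hz : z ∈ Metric.closedBall (0 : StrongDual ℂ (StrongDual ℂ X)) r) :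
    Summable (ClusterValue.aronBernerTerm f z) ∧
    ClusterValue.clusterSet r f z =
      WeakDual.gelfandTransform ℂ (ClusterValue.Hb X) f '' ClusterValue.fiber z r ∧
    WeakDual.gelfandTransform ℂ (ClusterValue.Hb X) f '' ClusterValue.fiber z r =
      {ClusterValue.aronBerner f z} := by
  have hz' : ‖z‖ ≤ r := (dist_zero_right z).symm.trans_le hz
  have hfib := ClusterValue.gelfandTransform_image_fiber hr hz' f
  exact ⟨f.summable_aronBernerTerm z,
    (ClusterValue.clusterSet_eq_singleton hr hz' f).trans hfib.symm, hfib⟩
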